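/- **Model.** For integers $n,T\ge 0$ and a finite set $D$, a $D$-way branching program of length (time) $T$ with Boolean output is a leveled rooted DAG whose nodes are partitioned into finite layers $L_0,\dots,L_T$ with $L_0=\{\text{root}\}$. Each node in a layer $L_t$ with $t<T$ is labeled by an input coordinate $i\in\{1,\dots,n\}$ and has $|D|$ outgoing edges, one for each possible value of $x_i\in D$, all leading to nodes of $L_{t+1}$. Each node of $L_T$ is a sink carrying an output bit. On input $x\in D^n$ one starts at the root and follows the edges given by the values of the queried coordinates; the output is the bit of the sink that is reached. The cumulative memory of $P$ is $CM(P)=\sum_{t=0}^{T}\log_2|L_t|$. **Problem.** Let $[N]=\{0,1,\dots,N-1\}$, each element being written in binary with $\lceil\log_2 N\rceil$ bits. The function $HAM_{1/8,n,N}:[N]^n\to\{0,1\}$ is $1$ on $x$ iff there are coordinates $i\ne j$ such that the Hamming distance between the binary representations of $x_i$ and $x_j$ is at most $\frac18\log_2 N$. **Theorem.** There is an absolute constant $C>0$ such that for every function $\tau:\mathbb N\to\mathbb R$ with $\tau(n)=o(n\log n)$ there is a function $\varepsilon:\mathbb N\to\mathbb R$ with $\varepsilon(n)\to 0$ as $n\to\infty$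 for which the following holds for all sufficiently large $n$: for every integer $N\ge n^{4.39}$, every integer $0\le T\le\tau(n)$, and every $[N]$-way branching program $P$ of length $T$ computing $HAM_{1/8,n,N}$, $$CM(P)\;\ge\;\frac{n^2\log_2 n}{2^{\,C\,T/n}}\;\ge\; n^{2-\varepsilon(n)}.$$ -/

import Mathlib

open Filter Topology Asymptotics

/-- A leveled `D`-way branching program of length (time) `T` on inputs `x ∈ D^n`, with Boolean
output.  Its nodes are split into `T + 1` finite layers; layer `0` is `{root}`; a node `v` in a
layer `t < T` is labeled by the input coordinate `query t v` and has one outgoing edge for each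
value `d ∈ D`, leading to the node `next t v d` of layer `t + 1`.  The nodes of the last layer are
the sinks, and each of them carries an output bit. -/
structure BranchingProgram (D : Type) (n T : ℕ) where
  Layer : Fin (T + 1) → Type
  fintypeLayer : ∀ t, Fintype (Layer t)
  root : Layer 0
  eq_root : ∀ v : Layer 0, v = root
  query : ∀ t : Fin T, Layer t.castSucc → Fin n
  next : ∀ t : Fin T, Layer t.castSucc → D → Layer t.succ
  output : Layer (Fin.last T) → Bool

namespace BranchingProgram

attribute [instance] BranchingProgram.fintypeLayer

variable {D : Type} {n T : ℕ}

/-- The node of layer `t` that the computation of `P` on input `x` reaches at time step `t`. -/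
def node (P : BranchingProgram D n T) (x : Fin n → D) (t : Fin (T + 1)) : P.Layer t :=
  Fin.induction (motive := P.Layer) P.root (fun s v => P.next s v (x (P.query s v))) t

/-- The output bit of `P` on input `x`. -/
def eval (P : BranchingProgram D n T) (x : Fin n → D) : Bool :=
  P.output (P.node x (Fin.last T))

/-- `P` computes `f` if it outputs `f x` on every input `x`. -/
def Computes (P : BranchingProgram D n T) (f : (Fin n → D) → Bool) : Prop :=
  ∀ x, P.eval x = f x

/-- Cumulative memory: `∑ t, log₂ |L_t|` over all layers `L_0, …, L_T`. -/
noncomputable def cumulativeMemory (P : BranchingProgram D n T) : ℝ :=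
  ∑ t : Fin (T + 1), Real.logb 2 (Fintype.card (P.Layer t))

end BranchingProgram

/-- The binary representation of `a ∈ {0, …, N - 1}` with `⌈log₂ N⌉` bits. -/
def binaryRep (N : ℕ) (a : Fin N) : Fin (Nat.clog 2 N) → Bool :=
  fun j => (a : ℕ).testBit j

open Classical in
/-- Hamming Closeness `HAM_{γ,n,N}`: is there a pair of distinct input coordinates whose values
have binary representations at Hamming distance at most `γ log₂ N`? -/
noncomputable def hammingCloseness (γ : ℝ) (n N : ℕ) (x : Fin n → Fin N) : Bool :=
  decide (∃ i j : Fin n, i ≠ j ∧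
    (hammingDist (binaryRep N (x i)) (binaryRep N (x j)) : ℝ) ≤ γ * Real.logb 2 N)

/-! Cut time into segments of length `h ≈ n² / (8T)`, with the offset chosen by averaging so that
the boundary layers carry at most a `1 / h` fraction of the cumulative memory. On a fixed input a
coordinate is read in at most `T / n` segments on average. Hence, with `K = ⌈T / n⌉` and `m ≈ n /
(16 · 16 ^ K)`, some set `E` of segments admits `m` coordinates `A` read only inside `E` and `m`
coordinates `B` read only outside it (`exists_split_of_sum_card_le`). Inputs that share `E`, `A`,
`B`, the boundary nodes, the output and all values off `A ∪ B` can exchange their `B`-parts without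
changing the output (`InClass.eval_piecewise`).

So, among such inputs without close pairs, each value seen at a coordinate of `A` is far from each
value seen at a coordinate of `B`. Isoperimetry on the cube makes one of the two value sets at most
`2 N ^ (1 - 1/512)`, and a class has density at most `(2 N ^ (-1/512)) ^ m` (`card_class_le`). There
are at most `2 ^ (T/h + 2) · (n.choose m)² · 2 ^ (CM/h)` classes, and they cover at least half of
all inputs (`pow_le_two_mul_card_zeros`). Taking logarithms, `CM` is at least of order `h m log n`,
which is `n² log n / 2 ^ O(T/n)`. -/

/-! ### Isoperimetry on the discrete cube. -/

theorem add_mul_add_le_of_mul_le {a₀ a₁ b₀ b₁ L M : ℝ} (ha₀ : 0 ≤ a₀) (ha₁ : 0 ≤ a₁)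
    (hb₀ : 0 ≤ b₀) (hb₁ : 0 ≤ b₁) (hL : 1 ≤ L) (h₀₀ : a₀ * b₀ ≤ M) (h₁₁ : a₁ * b₁ ≤ M)
    (h₀₁ : a₀ * b₁ ≤ L * M) (h₁₀ : a₁ * b₀ ≤ L * M) :
    (a₀ + a₁) * (b₀ + b₁) ≤ (2 + L + L⁻¹) * M := by
  have hL0 : 0 < L := by linarith
  have hM : 0 ≤ M := le_trans (mul_nonneg ha₀ hb₀) h₀₀
  have huv : (a₀ * b₁) * (a₁ * b₀) ≤ M * M := by
    calc (a₀ * b₁) * (a₁ * b₀) = (a₀ * b₀) * (a₁ * b₁) := by ring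
      _ ≤ M * M := mul_le_mul h₀₀ h₁₁ (mul_nonneg ha₁ hb₁) hM
  have key : a₀ * b₁ + a₁ * b₀ ≤ (L + L⁻¹) * M := by
    rcases hM.eq_or_lt with rfl | hM'
    · linarith
    -- For `u = a₀ b₁` and `v = a₁ b₀`, expand `(L M - u)(L M - v) ≥ 0` and use `u v ≤ M²`.
    have h1 : L * M * (a₀ * b₁ + a₁ * b₀) ≤ L * M * ((L + L⁻¹) * M) := by
      have e : L * M * ((L + L⁻¹) * M) = (L * M) ^ 2 + M * M := by field_simp
      rw [e]
      nlinarith [mul_nonneg (sub_nonneg.2 h₀₁) (sub_nonneg.2 h₁₀)]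
    exact le_of_mul_le_mul_left h1 (by positivity)
  calc (a₀ + a₁) * (b₀ + b₁) = a₀ * b₀ + a₁ * b₁ + (a₀ * b₁ + a₁ * b₀) := by ring
    _ ≤ M + M + (L + L⁻¹) * M := by linarith
    _ = (2 + L + L⁻¹) * M := by ring

theorem hammingDist_cons {ℓ : ℕ} (a b : Bool) (x y : Fin ℓ → Bool) :
    hammingDist (Fin.cons a x : Fin (ℓ + 1) → Bool) (Fin.cons b y) =
      (if a ≠ b then 1 else 0) + hammingDist x y := by
  simp only [hammingDist, Finset.card_filter, Fin.sum_univ_succ, Fin.cons_zero, Fin.cons_succ]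

theorem sum_boolVector_succ {ℓ : ℕ} (f : (Fin (ℓ + 1) → Bool) → ℝ) :
    ∑ x, f x = ∑ x : Fin ℓ → Bool, f (Fin.cons false x) + ∑ x : Fin ℓ → Bool, f (Fin.cons true x) := by
  rw [← (Fin.consEquiv (fun _ : Fin (ℓ + 1) => Bool)).sum_comp, Fintype.sum_prod_type,
    Fintype.sum_bool, add_comm]
  rfl

/-- A two-function form of the isoperimetric inequality on the discrete cube. -/
theorem sum_mul_sum_le_of_mul_le_pow_hammingDist {L : ℝ} (hL : 1 ≤ L) (ℓ : ℕ) :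
    ∀ (f g : (Fin ℓ → Bool) → ℝ) (M : ℝ), (∀ x, 0 ≤ f x) → (∀ x, 0 ≤ g x) →
      (∀ x y, f x * g y ≤ L ^ hammingDist x y * M) →
      (∑ x, f x) * (∑ y, g y) ≤ (2 + L + L⁻¹) ^ ℓ * M := by
  induction ℓ with
  | zero =>
    intro f g M _ _ h
    rw [Fintype.sum_subsingleton f default, Fintype.sum_subsingleton g default, pow_zero, one_mul]
    refine (h default default).trans (le_of_eq ?_)
    rw [hammingDist_self, pow_zero, one_mul]
  | succ ℓ ih =>
    intro f g M hf hg h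
    -- Tensorization: sections with different first bits lose one factor `L`, so the four section
    -- sums satisfy the two-point inequality.
    have sec : ∀ a b : Bool, (∑ x : Fin ℓ → Bool, f (Fin.cons a x)) *
        (∑ y : Fin ℓ → Bool, g (Fin.cons b y)) ≤
          (2 + L + L⁻¹) ^ ℓ * (L ^ (if a ≠ b then 1 else 0) * M) := by
      intro a b
      refine ih _ _ _ (fun _ => hf _) (fun _ => hg _) fun x y => (h _ _).trans (le_of_eq ?_)
      rw [hammingDist_cons, pow_add]; ring
    rw [sum_boolVector_succ, sum_boolVector_succ, pow_succ']
    have := add_mul_add_le_of_mul_le (M := (2 + L + L⁻¹) ^ ℓ * M)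
      (Finset.sum_nonneg fun (x : Fin ℓ → Bool) _ => hf (Fin.cons false x))
      (Finset.sum_nonneg fun (x : Fin ℓ → Bool) _ => hf (Fin.cons true x))
      (Finset.sum_nonneg fun (x : Fin ℓ → Bool) _ => hg (Fin.cons false x))
      (Finset.sum_nonneg fun (x : Fin ℓ → Bool) _ => hg (Fin.cons true x)) hL
      (by simpa using sec false false) (by simpa using sec true true)
      ((sec false true).trans (le_of_eq (by simp; ring)))
      ((sec true false).trans (le_of_eq (by simp; ring)))
    linarith

/-- The functional inequality with `f` the indicator of `A` and `g` that of `B` scaled by `L ^ d`.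
-/
theorem card_mul_card_mul_rpow_le {ℓ : ℕ} {L d : ℝ} (hL : 1 ≤ L) (A B : Finset (Fin ℓ → Bool))
    (h : ∀ x ∈ A, ∀ y ∈ B, d ≤ hammingDist x y) :
    (A.card : ℝ) * B.card * L ^ d ≤ (2 + L + L⁻¹) ^ ℓ := by
  classical
  have hL0 : 0 < L := by linarith
  have := sum_mul_sum_le_of_mul_le_pow_hammingDist hL ℓ (fun x => if x ∈ A then 1 else 0)
    (fun y => if y ∈ B then L ^ d else 0) 1 (fun x => by positivity) (fun x => by positivity)
    (fun x y => by
      by_cases hx : x ∈ A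
      · by_cases hy : y ∈ B
        · simp only [hx, hy, if_true, one_mul, mul_one]
          rw [← Real.rpow_natCast]
          exact Real.rpow_le_rpow_of_exponent_le hL (h x hx y hy)
        · simp only [hy, if_false, mul_zero]; positivity
      · simp only [hx, if_false, zero_mul]; positivity)
  simp only [Finset.sum_ite_mem, Finset.univ_inter, Finset.sum_const, nsmul_eq_mul, mul_one] at this
  linarith

set_option exponentiation.threshold 600 in
/-- Two sets in the discrete cube at linear distance have small product of densities. -/
theorem card_mul_card_le_two_pow_rpow {ℓ : ℕ} (A B : Finset (Fin ℓ → Bool))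
    (h : ∀ x ∈ A, ∀ y ∈ B, (ℓ : ℝ) / 16 ≤ hammingDist x y) :
    (A.card : ℝ) * B.card ≤ ((2 : ℝ) ^ ℓ) ^ (2 - 1 / 256 : ℝ) := by
  have h1 := card_mul_card_mul_rpow_le (L := 9 / 8) (by norm_num) A B h
  have hnum : (2 + 9 / 8 + (9 / 8 : ℝ)⁻¹) ≤ 2 ^ (2 - 1 / 256 : ℝ) * (9 / 8 : ℝ) ^ (1 / 16 : ℝ) := by
    -- The 256th power clears the exponents, leaving a rational inequality with right side `2 ^ 511
    -- * (9 / 8) ^ 16`.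
    have h2 : (2 + 9 / 8 + (9 / 8 : ℝ)⁻¹) ^ 256 ≤
        (2 ^ (2 - 1 / 256 : ℝ) * (9 / 8 : ℝ) ^ (1 / 16 : ℝ)) ^ 256 := by
      rw [mul_pow, ← Real.rpow_natCast, ← Real.rpow_natCast (_ ^ _), ← Real.rpow_natCast (_ ^ _),
        ← Real.rpow_mul (by norm_num), ← Real.rpow_mul (by norm_num)]
      have e1 : (2 - 1 / 256 : ℝ) * ((256 : ℕ) : ℝ) = ((511 : ℕ) : ℝ) := by norm_num
      have e2 : (1 / 16 : ℝ) * ((256 : ℕ) : ℝ) = ((16 : ℕ) : ℝ) := by norm_num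
      rw [e1, e2, Real.rpow_natCast, Real.rpow_natCast, Real.rpow_natCast]
      norm_num
    exact le_of_pow_le_pow_left₀ (by norm_num) (by positivity) h2
  have h3 : (2 + 9 / 8 + (9 / 8 : ℝ)⁻¹) ^ ℓ ≤
      ((2 : ℝ) ^ ℓ) ^ (2 - 1 / 256 : ℝ) * (9 / 8 : ℝ) ^ ((ℓ : ℝ) / 16) := by
    refine (pow_le_pow_left₀ (by norm_num) hnum ℓ).trans (le_of_eq ?_)
    rw [mul_pow, ← Real.rpow_natCast, ← Real.rpow_natCast (_ ^ _), ← Real.rpow_natCast 2,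
      ← Real.rpow_mul (by norm_num), ← Real.rpow_mul (by norm_num), ← Real.rpow_mul (by norm_num)]
    congr 2 <;> ring
  exact le_of_mul_le_mul_right (h1.trans h3) (by positivity)

/-! ### Binary representations, Hamming balls and the number of inputs without close pairs. -/

theorem binaryRep_injective (N : ℕ) : Function.Injective (binaryRep N) := by
  intro a b h
  refine Fin.ext (Nat.eq_of_testBit_eq fun j => ?_)
  by_cases hj : j < Nat.clog 2 N
  · exact congrFun h ⟨j, hj⟩
  · have hN : N ≤ 2 ^ j := (Nat.le_pow_clog one_lt_two N).trans
      (Nat.pow_le_pow_right two_pos (not_lt.1 hj))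
    rw [Nat.testBit_lt_two_pow (a.2.trans_le hN), Nat.testBit_lt_two_pow (b.2.trans_le hN)]

theorem two_pow_clog_le {N : ℕ} (hN : 1 ≤ N) : 2 ^ Nat.clog 2 N ≤ 2 * N := by
  rcases hN.eq_or_lt with rfl | hN
  · simp
  have h1 := Nat.pow_pred_clog_lt_self one_lt_two hN
  have h2 : 0 < Nat.clog 2 N := Nat.clog_pos one_lt_two hN
  obtain ⟨j, hj⟩ : ∃ j, Nat.clog 2 N = j + 1 := ⟨_, (Nat.succ_pred_eq_of_pos h2).symm⟩
  rw [hj] at h1 ⊢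
  simp only [Nat.pred_succ] at h1
  rw [pow_succ]; omega

theorem clog_le_logb_add_one {N : ℕ} (hN : 1 ≤ N) : (Nat.clog 2 N : ℝ) ≤ Real.logb 2 N + 1 := by
  have hN' : (0 : ℝ) < N := by exact_mod_cast hN
  have h : ((2 : ℝ) ^ (Nat.clog 2 N : ℕ)) ≤ 2 * N := by exact_mod_cast two_pow_clog_le hN
  have h2 := Real.logb_le_logb_of_le one_lt_two (by positivity) h
  rw [Real.logb_pow, Real.logb_mul (by norm_num) hN'.ne', Real.logb_self_eq_one one_lt_two] at h2
  linarith

/-- Sets of numbers whose binary representations are pairwise far apart cannot both be large. -/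
theorem card_le_or_card_le_of_far {N : ℕ} (hN : 2 ≤ N) (A B : Finset (Fin N))
    (h : ∀ a ∈ A, ∀ b ∈ B,
      1 / 8 * Real.logb 2 N < hammingDist (binaryRep N a) (binaryRep N b)) :
    (A.card : ℝ) ≤ 2 * (N : ℝ) ^ (1 - 1 / 512 : ℝ) ∨
      (B.card : ℝ) ≤ 2 * (N : ℝ) ^ (1 - 1 / 512 : ℝ) := by
  classical
  have hN' : (0 : ℝ) < N := by positivity
  have hlog : 1 ≤ Real.logb 2 N := by
    rw [Real.le_logb_iff_rpow_le one_lt_two hN']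
    simpa using (by exact_mod_cast hN : (2 : ℝ) ≤ N)
  have hcl := clog_le_logb_add_one (show 1 ≤ N by omega)
  -- The word length is at most `log₂ N + 1 ≤ 2 log₂ N`, so distance above `log₂ N / 8` exceeds a
  -- sixteenth of it.
  have h1 := card_mul_card_le_two_pow_rpow (A.image (binaryRep N)) (B.image (binaryRep N)) (by
    intro x hx y hy
    obtain ⟨a, ha, rfl⟩ := Finset.mem_image.1 hx
    obtain ⟨b, hb, rfl⟩ := Finset.mem_image.1 hy
    have := h a ha b hb
    linarith)
  rw [Finset.card_image_of_injective _ (binaryRep_injective N),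
    Finset.card_image_of_injective _ (binaryRep_injective N)] at h1
  have h2 : ((2 : ℝ) ^ Nat.clog 2 N) ^ (2 - 1 / 256 : ℝ) ≤ (2 * (N : ℝ) ^ (1 - 1 / 512 : ℝ)) ^ 2 := by
    calc ((2 : ℝ) ^ Nat.clog 2 N) ^ (2 - 1 / 256 : ℝ) ≤ (2 * N : ℝ) ^ (2 - 1 / 256 : ℝ) :=
          Real.rpow_le_rpow (by positivity)
            (by exact_mod_cast two_pow_clog_le (show 1 ≤ N by omega)) (by norm_num)
      _ = 2 ^ (2 - 1 / 256 : ℝ) * (N : ℝ) ^ (2 - 1 / 256 : ℝ) :=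
          Real.mul_rpow (by norm_num) hN'.le
      _ ≤ 2 ^ (2 : ℝ) * (N : ℝ) ^ (2 - 1 / 256 : ℝ) := by
          gcongr
          · norm_num
          · norm_num
      _ = (2 * (N : ℝ) ^ (1 - 1 / 512 : ℝ)) ^ 2 := by
          rw [mul_pow, ← Real.rpow_natCast (_ ^ _), ← Real.rpow_mul hN'.le]
          norm_num
  by_contra! hcon
  have h3 := mul_lt_mul'' hcon.1 hcon.2 (by positivity) (by positivity)
  nlinarith

theorem sum_pow_hammingDist {ℓ : ℕ} (x : Fin ℓ → Bool) (ρ : ℝ) :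
    ∑ y, ρ ^ hammingDist x y = (1 + ρ) ^ ℓ := by
  calc ∑ y, ρ ^ hammingDist x y = ∑ y : Fin ℓ → Bool, ∏ i, (if x i ≠ y i then ρ else 1) := by
        refine Finset.sum_congr rfl fun y _ => ?_
        rw [hammingDist, ← Finset.prod_const, Finset.prod_filter]
    _ = ∏ i, ∑ b : Bool, (if x i ≠ b then ρ else 1) := by
        rw [Finset.prod_univ_sum, Fintype.piFinset_univ]
    _ = (1 + ρ) ^ ℓ := by
        have : ∀ i, ∑ b : Bool, (if x i ≠ b then ρ else 1) = 1 + ρ := by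
          intro i
          cases x i <;> simp [add_comm]
        rw [Finset.prod_congr rfl fun i _ => this i]
        simp

/-- Chernoff bound for the volume of a Hamming ball among the numbers below `N`. -/
theorem card_near_mul_rpow_le {N : ℕ} (a : Fin N) {ρ r : ℝ} (hρ0 : 0 < ρ) (hρ : ρ ≤ 1) :
    ((Finset.univ.filter fun b : Fin N =>
      (hammingDist (binaryRep N a) (binaryRep N b) : ℝ) ≤ r).card : ℝ) * ρ ^ r ≤
        (1 + ρ) ^ Nat.clog 2 N := by
  classical
  rw [← sum_pow_hammingDist (binaryRep N a) ρ, ← nsmul_eq_mul, ← Finset.sum_const]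
  calc _ ≤ ∑ b ∈ (Finset.univ.filter fun b : Fin N =>
        (hammingDist (binaryRep N a) (binaryRep N b) : ℝ) ≤ r),
          ρ ^ hammingDist (binaryRep N a) (binaryRep N b) := by
        refine Finset.sum_le_sum fun b hb => ?_
        rw [← Real.rpow_natCast]
        exact Real.rpow_le_rpow_of_exponent_ge hρ0 hρ (Finset.mem_filter.1 hb).2
    _ ≤ ∑ b : Fin N, ρ ^ hammingDist (binaryRep N a) (binaryRep N b) :=
        Finset.sum_le_sum_of_subset_of_nonneg (Finset.subset_univ _)
          (fun b _ _ => by positivity)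
    _ = ∑ y ∈ Finset.univ.image (binaryRep N), ρ ^ hammingDist (binaryRep N a) y := by
        rw [Finset.sum_image ((binaryRep_injective N).injOn)]
    _ ≤ _ := Finset.sum_le_sum_of_subset_of_nonneg (Finset.subset_univ _)
          (fun b _ _ => by positivity)

/-- This is `2 ^ 160 ≤ 7 ^ 57`, precise enough that `3 - (7/8) * (160/57) < 0.54387`. -/
theorem logb_two_seven_ge : (160 / 57 : ℝ) ≤ Real.logb 2 7 := by
  rw [Real.le_logb_iff_rpow_le one_lt_two (by norm_num)]
  refine le_of_pow_le_pow_left₀ (n := 57) (by norm_num) (by norm_num) ?_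
  rw [← Real.rpow_natCast, ← Real.rpow_mul (by norm_num)]
  have : (160 / 57 : ℝ) * ((57 : ℕ) : ℝ) = ((160 : ℕ) : ℝ) := by norm_num
  rw [this, Real.rpow_natCast]
  norm_num

/-- The Chernoff bound at its optimal parameter `ρ = (1/8) / (7/8) = 1/7`; the exponent slightly
exceeds the binary entropy of `1/8`. The factor 2 pays for rounding `log₂ N` up. -/
theorem card_near_le {N : ℕ} (a : Fin N) :
    ((Finset.univ.filter fun b : Fin N =>
      (hammingDist (binaryRep N a) (binaryRep N b) : ℝ) ≤ 1 / 8 * Real.logb 2 N).card : ℝ) ≤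
        2 * (N : ℝ) ^ (0.54387 : ℝ) := by
  have hN : 1 ≤ N := a.pos
  have hN' : (0 : ℝ) < N := by exact_mod_cast hN
  have hN1 : (1 : ℝ) ≤ N := by exact_mod_cast hN
  have hlog : 0 ≤ Real.logb 2 N := Real.logb_nonneg one_lt_two hN1
  have h1 := card_near_mul_rpow_le a (ρ := 1 / 7) (r := 1 / 8 * Real.logb 2 N)
    (by norm_num) (by norm_num)
  have h7 := logb_two_seven_ge
  have e7 : (2 : ℝ) ^ Real.logb 2 7 = 7 := Real.rpow_logb two_pos (by norm_num) (by norm_num)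
  have eN : (2 : ℝ) ^ Real.logb 2 N = N := Real.rpow_logb two_pos (by norm_num) hN'
  have e87 : (1 + 1 / 7 : ℝ) = 2 ^ (3 - Real.logb 2 7) := by
    rw [Real.rpow_sub two_pos, e7]; norm_num
  have e17 : (1 / 7 : ℝ) ^ (1 / 8 * Real.logb 2 N) = (7 ^ (1 / 8 * Real.logb 2 (N : ℝ)))⁻¹ := by
    rw [one_div (7 : ℝ), Real.inv_rpow (by norm_num)]
  have h2 : (1 + 1 / 7 : ℝ) ^ Nat.clog 2 N ≤
      2 * (N : ℝ) ^ (0.54387 : ℝ) * (1 / 7 : ℝ) ^ (1 / 8 * Real.logb 2 N) := by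
    calc (1 + 1 / 7 : ℝ) ^ Nat.clog 2 N = (1 + 1 / 7 : ℝ) ^ (Nat.clog 2 N : ℝ) :=
          (Real.rpow_natCast _ _).symm
      _ ≤ (1 + 1 / 7 : ℝ) ^ (Real.logb 2 N + 1) :=
          Real.rpow_le_rpow_of_exponent_le (by norm_num) (clog_le_logb_add_one hN)
      _ ≤ 2 * (1 + 1 / 7 : ℝ) ^ (Real.logb 2 N) := by
          rw [Real.rpow_add (by norm_num), Real.rpow_one]
          have : 0 < (1 + 1 / 7 : ℝ) ^ (Real.logb 2 N) := by positivity
          linarith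
      _ = 2 * 2 ^ ((3 - Real.logb 2 7) * Real.logb 2 N) := by
          rw [e87, Real.rpow_mul two_pos.le]
      _ ≤ 2 * 2 ^ (0.54387 * Real.logb 2 N - Real.logb 2 7 * (1 / 8 * Real.logb 2 N)) := by
          refine mul_le_mul_of_nonneg_left
            (Real.rpow_le_rpow_of_exponent_le (by norm_num) ?_) two_pos.le
          nlinarith
      _ = 2 * (N : ℝ) ^ (0.54387 : ℝ) * (1 / 7 : ℝ) ^ (1 / 8 * Real.logb 2 N) := by
          rw [Real.rpow_sub two_pos, Real.rpow_mul two_pos.le (Real.logb 2 7), e7,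
            mul_comm (0.54387 : ℝ), Real.rpow_mul two_pos.le, eN, e17]
          ring
  exact le_of_mul_le_mul_right (h1.trans h2) (by positivity)

theorem hammingCloseness_eq_false_iff {γ : ℝ} {n N : ℕ} {x : Fin n → Fin N} :
    hammingCloseness γ n N x = false ↔ ∀ i j : Fin n, i ≠ j →
      γ * Real.logb 2 N < hammingDist (binaryRep N (x i)) (binaryRep N (x j)) := by
  simp [hammingCloseness]

/-- Exchanging `x j` with the free value `b` injects pairs `(x, b)` into pairs of an arbitrary input
and an element related to its `i`-th value. -/
theorem card_filter_apply_rel_le {n N : ℕ} {i j : Fin n} (hij : i ≠ j) (r : Fin N → Fin N → Prop)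
    [DecidableRel r] (V : ℕ) (hV : ∀ a, (Finset.univ.filter (r a)).card ≤ V) :
    (Finset.univ.filter fun x : Fin n → Fin N => r (x i) (x j)).card * N ≤ V * N ^ n := by
  classical
  have hfib : ∀ x : Fin n → Fin N, (Finset.univ.filter fun b => r (x i) b).card ≤ V := fun x => hV _
  have h := Finset.card_le_card_of_injOn
    (s := (Finset.univ.filter fun x : Fin n → Fin N => r (x i) (x j)) ×ˢ (Finset.univ : Finset (Fin N)))
    (t := (Finset.univ : Finset (Fin n → Fin N)).sigma
      fun x => Finset.univ.filter fun b => r (x i) b)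
    (fun p => ⟨Function.update p.1 j p.2, p.1 j⟩)
    (by
      rintro ⟨x, b⟩ hx
      simp only [Finset.coe_product, Set.mem_prod, Finset.coe_filter, Finset.mem_univ, true_and,
        Set.mem_ofPred_eq] at hx
      simpa [Function.update_of_ne hij] using hx.1)
    (by
      rintro ⟨x, b⟩ _ ⟨y, c⟩ _ hxy
      simp only [Sigma.mk.injEq, heq_eq_eq] at hxy
      obtain ⟨h1, h2⟩ := hxy
      have hbc : b = c := by simpa using congrFun h1 j
      refine Prod.ext (funext fun k => ?_) hbc
      by_cases hk : k = j
      · subst hk; exact h2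
      · simpa [Function.update_of_ne hk] using congrFun h1 k)
  rw [Finset.card_product, Finset.card_sigma, Finset.card_univ, Fintype.card_fin] at h
  refine h.trans ((Finset.sum_le_card_nsmul _ _ V fun x _ => hfib x).trans (le_of_eq ?_))
  simp [mul_comm]

/-- For `N ≥ n ^ 4.39` and large `n`, at least half of all inputs have no close pair. -/
theorem pow_le_two_mul_card_zeros {n N : ℕ} (hn : (4 : ℝ) ≤ (n : ℝ) ^ (0.0024107 : ℝ))
    (hN : (n : ℝ) ^ (4.39 : ℝ) ≤ N) :
    (N : ℝ) ^ n ≤ 2 * ((Finset.univ.filter fun x : Fin n → Fin N =>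
      hammingCloseness (1 / 8) n N x = false).card : ℝ) := by
  classical
  have hn0 : (0 : ℝ) < n := by
    rcases Nat.eq_zero_or_pos n with rfl | h
    · rw [Nat.cast_zero, Real.zero_rpow (by norm_num)] at hn; linarith
    · exact_mod_cast h
  have hN' : (0 : ℝ) < N := lt_of_lt_of_le (by positivity) hN
  set r : Fin N → Fin N → Prop := fun a b =>
    (hammingDist (binaryRep N a) (binaryRep N b) : ℝ) ≤ 1 / 8 * Real.logb 2 N with hr
  set bad : Fin n × Fin n → Finset (Fin n → Fin N) := fun p =>
    Finset.univ.filter fun x => r (x p.1) (x p.2) with hbad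
  set V : ℕ := ⌊2 * (N : ℝ) ^ (0.54387 : ℝ)⌋₊ with hVdef
  have hV : ∀ a, (Finset.univ.filter (r a)).card ≤ V := fun a => Nat.le_floor (card_near_le a)
  have hVle : (V : ℝ) ≤ 2 * (N : ℝ) ^ (0.54387 : ℝ) := Nat.floor_le (by positivity)
  have hcov : (Finset.univ : Finset (Fin n → Fin N)) ⊆
      (Finset.univ.filter fun x : Fin n → Fin N => hammingCloseness (1 / 8) n N x = false) ∪
        (Finset.univ.filter fun p : Fin n × Fin n => p.1 ≠ p.2).biUnion bad := by
    intro x _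
    by_cases hx : hammingCloseness (1 / 8) n N x = false
    · exact Finset.mem_union_left _ (by simpa using hx)
    · refine Finset.mem_union_right _ ?_
      rw [hammingCloseness_eq_false_iff] at hx
      push Not at hx
      obtain ⟨i, j, hij, h⟩ := hx
      exact Finset.mem_biUnion.2 ⟨(i, j), by simpa using hij, by simpa [hbad, hr] using h⟩
  have hcard := (Finset.card_le_card hcov).trans (Finset.card_union_le _ _)
  rw [Finset.card_univ, Fintype.card_fun, Fintype.card_fin, Fintype.card_fin] at hcard
  have hbadle : (((Finset.univ.filter fun p : Fin n × Fin n => p.1 ≠ p.2).biUnion bad).card : ℝ) * N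
      ≤ (n : ℝ) ^ 2 * (V * (N : ℝ) ^ n) := by
    have h1 : ((Finset.univ.filter fun p : Fin n × Fin n => p.1 ≠ p.2).biUnion bad).card * N ≤
        n ^ 2 * (V * N ^ n) := by
      calc _ ≤ (∑ p ∈ (Finset.univ.filter fun p : Fin n × Fin n => p.1 ≠ p.2), (bad p).card) * N :=
            Nat.mul_le_mul_right _ Finset.card_biUnion_le
        _ = ∑ p ∈ (Finset.univ.filter fun p : Fin n × Fin n => p.1 ≠ p.2), (bad p).card * N :=
            Finset.sum_mul _ _ _
        _ ≤ ∑ p ∈ (Finset.univ.filter fun p : Fin n × Fin n => p.1 ≠ p.2), V * N ^ n :=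
            Finset.sum_le_sum fun p hp =>
              card_filter_apply_rel_le (Finset.mem_filter.1 hp).2 r V hV
        _ ≤ ∑ p : Fin n × Fin n, V * N ^ n :=
            Finset.sum_le_sum_of_subset (Finset.subset_univ _)
        _ = n ^ 2 * (V * N ^ n) := by simp [sq, Fintype.card_prod]
    exact_mod_cast h1
  -- The exponent 4.39 enters here: `4.39 * (1 - 0.54387) = 2.0024107`, and the excess over 2
  -- absorbs the factor 4.
  have hsmall : (n : ℝ) ^ 2 * V * 2 ≤ N := by
    have e2 : (n : ℝ) ^ 2 * 4 ≤ (n : ℝ) ^ (4.39 * 0.45613 : ℝ) := by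
      have : (4.39 * 0.45613 : ℝ) = (2 : ℕ) + 0.0024107 := by norm_num
      rw [this, Real.rpow_add hn0, Real.rpow_natCast]
      gcongr
    have e3 : (n : ℝ) ^ (4.39 * 0.45613 : ℝ) ≤ (N : ℝ) ^ (0.45613 : ℝ) := by
      rw [Real.rpow_mul hn0.le]
      exact Real.rpow_le_rpow (by positivity) hN (by norm_num)
    calc (n : ℝ) ^ 2 * V * 2 ≤ (n : ℝ) ^ 2 * (2 * (N : ℝ) ^ (0.54387 : ℝ)) * 2 := by gcongr
      _ = ((n : ℝ) ^ 2 * 4) * (N : ℝ) ^ (0.54387 : ℝ) := by ring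
      _ ≤ (N : ℝ) ^ (0.45613 : ℝ) * (N : ℝ) ^ (0.54387 : ℝ) := by
          gcongr; exact e2.trans e3
      _ = N := by rw [← Real.rpow_add hN']; norm_num
  have hcard' : (N : ℝ) ^ n ≤ ((Finset.univ.filter fun x : Fin n → Fin N =>
      hammingCloseness (1 / 8) n N x = false).card : ℝ) +
        ((Finset.univ.filter fun p : Fin n × Fin n => p.1 ≠ p.2).biUnion bad).card := by
    exact_mod_cast hcard
  have hb2 : (((Finset.univ.filter fun p : Fin n × Fin n => p.1 ≠ p.2).biUnion bad).card : ℝ) * 2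
      ≤ (N : ℝ) ^ n := by
    refine le_of_mul_le_mul_right ?_ hN'
    have : (0 : ℝ) < (N : ℝ) ^ n := by positivity
    nlinarith
  linarith

/-! ### Splitting the segments between two groups of coordinates. -/

theorem card_le_two_mul_card_filter_le {ι : Type*} [Fintype ι] (w : ι → ℕ) {K : ℕ} (hK : 1 ≤ K)
    (hw : ∑ i, w i ≤ K * Fintype.card ι) :
    Fintype.card ι ≤ 2 * (Finset.univ.filter fun i => w i ≤ 2 * K).card := by
  have h1 : (Finset.univ.filter fun i => ¬ w i ≤ 2 * K).card * (2 * K) ≤ ∑ i, w i := by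
    rw [← smul_eq_mul]
    refine (Finset.card_nsmul_le_sum _ w _ fun i hi => ?_).trans
      (Finset.sum_le_sum_of_subset (Finset.subset_univ _))
    have := (Finset.mem_filter.1 hi).2
    omega
  have h2 := Finset.card_filter_add_card_filter_not (s := (Finset.univ : Finset ι))
    (fun i => w i ≤ 2 * K)
  rw [Finset.card_univ] at h2
  have h3 : 2 * (Finset.univ.filter fun i => ¬ w i ≤ 2 * K).card ≤ Fintype.card ι := by
    refine le_of_mul_le_mul_left (a := K) ?_ hK
    calc _ = (Finset.univ.filter fun i => ¬ w i ≤ 2 * K).card * (2 * K) := by ring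
      _ ≤ _ := h1.trans hw
  omega

/-- Charge an intersecting pair `(i, j)` to some `s ∈ S i` that also lies in `S j`: there are at
most `T` choices of `(i, s)`, then `h` of `j`. -/
theorem card_not_disjoint_le {ι σ : Type*} [Fintype ι] [DecidableEq ι] [DecidableEq σ]
    (S : ι → Finset σ) {T h : ℕ} (hT : ∑ i, (S i).card ≤ T)
    (hfib : ∀ s, (Finset.univ.filter fun i => s ∈ S i).card ≤ h) :
    (Finset.univ.filter fun p : ι × ι => ¬ Disjoint (S p.1) (S p.2)).card ≤ T * h := by
  have hsub : (Finset.univ.filter fun p : ι × ι => ¬ Disjoint (S p.1) (S p.2)) ⊆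
      (Finset.univ.sigma S).biUnion fun q =>
        (Finset.univ.filter fun j => q.2 ∈ S j).image (Prod.mk q.1) := by
    rintro ⟨i, j⟩ hp
    obtain ⟨s, hi, hj⟩ := Finset.not_disjoint_iff.1 (Finset.mem_filter.1 hp).2
    exact Finset.mem_biUnion.2 ⟨⟨i, s⟩, by simpa using hi, by simpa using hj⟩
  refine (Finset.card_le_card hsub).trans ((Finset.card_biUnion_le_card_mul _ _ h
    fun q _ => Finset.card_image_le.trans (hfib _)).trans ?_)
  rw [Finset.card_sigma]
  exact Nat.mul_le_mul_right _ hT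

/-- If the sets `S i` have small average size and small degrees, the ground set can be split in two
parts each of which contains many of the sets. -/
theorem exists_split_of_sum_card_le {ι σ : Type*} [Fintype ι] [DecidableEq ι] [Fintype σ]
    [DecidableEq σ] (S : ι → Finset σ) {T K h m : ℕ} (hι : 0 < Fintype.card ι) (hK : 1 ≤ K)
    (hT : ∑ i, (S i).card ≤ T) (hTK : T ≤ K * Fintype.card ι)
    (hfib : ∀ s, (Finset.univ.filter fun i => s ∈ S i).card ≤ h)
    (hh : 8 * (T * h) ≤ Fintype.card ι ^ 2) (hm : 16 * m * 16 ^ K ≤ Fintype.card ι) :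
    ∃ (E : Finset σ) (A B : Finset ι), A.card = m ∧ B.card = m ∧ Disjoint A B ∧
      (∀ i ∈ A, S i ⊆ E) ∧ ∀ i ∈ B, Disjoint (S i) E := by
  set n := Fintype.card ι with hn
  set R := Fintype.card σ with hR
  let I : Finset ι := Finset.univ.filter fun i => (S i).card ≤ 2 * K
  let D : Finset (ι × ι) := (I ×ˢ I).filter fun p => Disjoint (S p.1) (S p.2)
  let ME : Finset σ → Finset ι := fun E => Finset.univ.filter fun i => S i ⊆ E
  let MF : Finset σ → Finset ι := fun E => Finset.univ.filter fun i => Disjoint (S i) E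
  have hI : n ≤ 2 * I.card := card_le_two_mul_card_filter_le _ hK (hT.trans hTK)
  -- At least `n² / 4` pairs have both sets of size at most `2 K`, and at most `n² / 8` pairs
  -- intersect.
  have hD : n ^ 2 ≤ 8 * D.card := by
    have h1 := Finset.card_filter_add_card_filter_not (s := I ×ˢ I)
      (fun p => Disjoint (S p.1) (S p.2))
    have h2 : ((I ×ˢ I).filter fun p => ¬ Disjoint (S p.1) (S p.2)).card ≤ T * h :=
      (Finset.card_le_card (Finset.filter_subset_filter _ (Finset.subset_univ _))).trans
        (card_not_disjoint_le S hT hfib)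
    rw [Finset.card_product] at h1
    have h3 : D.card = ((I ×ˢ I).filter fun p => Disjoint (S p.1) (S p.2)).card := rfl
    have h4 : n * n ≤ (2 * I.card) * (2 * I.card) := Nat.mul_le_mul hI hI
    nlinarith
  -- A uniformly random `E` contains `S i` and avoids `S j` with probability `2 ^ (-|S i| - |S j|) ≥
  -- 16 ^ (-K)`; sum over the pairs in `D`.
  have hcount : D.card * 2 ^ R ≤ (∑ E, (ME E).card * (MF E).card) * 16 ^ K := by
    have h1 : ∀ p ∈ D, 2 ^ R ≤
        (Finset.univ.filter fun E => S p.1 ⊆ E ∧ Disjoint (S p.2) E).card * 16 ^ K := by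
      intro p hp
      simp only [D, I, Finset.mem_filter, Finset.mem_product, Finset.mem_univ, true_and] at hp
      have hset : (Finset.univ.filter fun E => S p.1 ⊆ E ∧ Disjoint (S p.2) E) =
          Finset.Icc (S p.1) (S p.2)ᶜ := by
        ext E
        simp only [Finset.mem_filter, Finset.mem_univ, true_and, Finset.mem_Icc]
        rw [disjoint_comm, Finset.subset_compl_iff_disjoint_right]
      rw [hset, Finset.card_Icc_finset (Finset.subset_compl_iff_disjoint_right.2 hp.2),
        Finset.card_compl, show (16 : ℕ) = 2 ^ 4 from rfl, ← pow_mul, ← pow_add]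
      exact Nat.pow_le_pow_right two_pos (by omega)
    calc D.card * 2 ^ R = ∑ p ∈ D, 2 ^ R := by simp
      _ ≤ ∑ p ∈ D, (Finset.univ.filter fun E => S p.1 ⊆ E ∧ Disjoint (S p.2) E).card * 16 ^ K :=
          Finset.sum_le_sum h1
      _ ≤ ∑ p : ι × ι, (Finset.univ.filter fun E => S p.1 ⊆ E ∧ Disjoint (S p.2) E).card * 16 ^ K :=
          Finset.sum_le_sum_of_subset (Finset.subset_univ _)
      _ = (∑ p : ι × ι, (Finset.univ.filter fun E => S p.1 ⊆ E ∧ Disjoint (S p.2) E).card) *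
            16 ^ K := (Finset.sum_mul _ _ _).symm
      _ = (∑ E, (ME E).card * (MF E).card) * 16 ^ K := by
          congr 1
          simp only [Finset.card_filter]
          rw [Finset.sum_comm]
          refine Finset.sum_congr rfl fun E _ => ?_
          rw [← Finset.card_filter, ← Finset.card_product]
          congr 1
          ext p
          simp [ME, MF]
  obtain ⟨E, hE⟩ : ∃ E : Finset σ, n ^ 2 ≤ 8 * ((ME E).card * (MF E).card) * 16 ^ K := by
    by_contra! hcon
    have h1 : ∑ E : Finset σ, 8 * ((ME E).card * (MF E).card) * 16 ^ K < ∑ _E : Finset σ, n ^ 2 :=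
      Finset.sum_lt_sum_of_nonempty Finset.univ_nonempty fun E _ => hcon E
    rw [← Finset.sum_mul, ← Finset.mul_sum, Finset.sum_const, Finset.card_univ,
      Fintype.card_finset, smul_eq_mul] at h1
    have h2 : 2 ^ R * n ^ 2 ≤ 2 ^ R * (8 * D.card) := Nat.mul_le_mul_left _ hD
    have h3 : 8 * (D.card * 2 ^ R) ≤ 8 * ((∑ E, (ME E).card * (MF E).card) * 16 ^ K) :=
      Nat.mul_le_mul_left _ hcount
    have : 2 ^ R * n ^ 2 < 2 ^ R * n ^ 2 := by
      calc 2 ^ R * n ^ 2 ≤ 8 * (D.card * 2 ^ R) := h2.trans (le_of_eq (by ring))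
        _ ≤ _ := h3
        _ < _ := by rw [← mul_assoc]; exact h1
    exact lt_irrefl _ this
  have hlarge : ∀ a b : ℕ, n ^ 2 ≤ 8 * (a * b) * 16 ^ K → a ≤ n → 2 * m ≤ b := by
    intro a b hab ha
    have h1 : n * n ≤ n * (8 * b * 16 ^ K) := by
      calc n * n = n ^ 2 := (sq n).symm
        _ ≤ 8 * (a * b) * 16 ^ K := hab
        _ ≤ 8 * (n * b) * 16 ^ K := by gcongr
        _ = n * (8 * b * 16 ^ K) := by ring
    have h2 : 8 * 16 ^ K * (2 * m) ≤ 8 * 16 ^ K * b := by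
      calc 8 * 16 ^ K * (2 * m) = 16 * m * 16 ^ K := by ring
        _ ≤ n := hm
        _ ≤ 8 * b * 16 ^ K := Nat.le_of_mul_le_mul_left h1 hι
        _ = _ := by ring
    exact Nat.le_of_mul_le_mul_left h2 (by positivity)
  have hF : 2 * m ≤ (MF E).card := hlarge _ _ hE (Finset.card_le_univ _)
  have hE' : 2 * m ≤ (ME E).card :=
    hlarge _ _ (hE.trans (le_of_eq (by ring))) (Finset.card_le_univ (MF E))
  -- Indices with empty `S i` lie in both `ME E` and `MF E`; having `2 * m` elements in `MF E`
  -- leaves room to choose `B` off `A`.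
  obtain ⟨A, hA, hAm⟩ := Finset.exists_subset_card_eq (show m ≤ (ME E).card by omega)
  have h2 : m ≤ (MF E \ A).card := by
    have := Finset.le_card_sdiff A (MF E)
    omega
  obtain ⟨B, hB, hBm⟩ := Finset.exists_subset_card_eq h2
  refine ⟨E, A, B, hAm, hBm, ?_, fun i hi => ?_, fun i hi => ?_⟩
  · exact Finset.disjoint_of_subset_right hB Finset.disjoint_sdiff
  · exact (Finset.mem_filter.1 (hA hi)).2
  · exact (Finset.mem_filter.1 (Finset.mem_sdiff.1 (hB hi)).1).2

/-! ### Crossing over two computations at segment boundaries. -/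

namespace BranchingProgram

section Crossover

variable {D σ : Type} {n T : ℕ} (P : BranchingProgram D n T)

theorem node_succ (x : Fin n → D) (t : Fin T) :
    P.node x t.succ =
      P.next t (P.node x t.castSucc) (x (P.query t (P.node x t.castSucc))) := by
  simp only [node, Fin.induction_succ]

/-- The coordinate queried at time `t` on input `x`. -/
def queryAt (x : Fin n → D) (t : Fin T) : Fin n := P.query t (P.node x t.castSucc)

theorem node_succ_congr {x z : Fin n → D} {t : Fin T} (h : P.node z t.castSucc = P.node x t.castSucc)
    (hq : z (P.queryAt x t) = x (P.queryAt x t)) : P.node z t.succ = P.node x t.succ := by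
  rw [node_succ, node_succ, h]
  exact congrArg _ hq

theorem node_eq_of_forall_queryAt {x z : Fin n → D}
    (h : ∀ t, z (P.queryAt x t) = x (P.queryAt x t)) (t : Fin (T + 1)) :
    P.node z t = P.node x t := by
  induction t using Fin.induction with
  | zero => rfl
  | succ t ih => exact P.node_succ_congr ih (h t)

/-- If `x` and `y` pass through the same nodes at the boundaries between segments, and `z` agrees
with `x` on what `x` reads in the segments of `E` and with `y` on what `y` reads in the others,
then the computation on `z` follows `x` in `E` and `y` outside. -/
theorem node_crossover (seg : Fin (T + 1) → σ) (W : Finset (Fin (T + 1)))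
    (hseg : ∀ t : Fin T, t.succ ∉ W → seg t.succ = seg t.castSucc) (E : Finset σ)
    {x y z : Fin n → D} (hW : ∀ t ∈ W, P.node x t = P.node y t)
    (hx : ∀ t : Fin T, seg t.castSucc ∈ E → z (P.queryAt x t) = x (P.queryAt x t))
    (hy : ∀ t : Fin T, seg t.castSucc ∉ E → z (P.queryAt y t) = y (P.queryAt y t))
    (t : Fin (T + 1)) :
    (seg t ∈ E → P.node z t = P.node x t) ∧ (seg t ∉ E → P.node z t = P.node y t) := by
  induction t using Fin.induction with
  | zero => exact ⟨fun _ => rfl, fun _ => rfl⟩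
  | succ t ih =>
    by_cases hE : seg t.castSucc ∈ E
    · have h1 := P.node_succ_congr (ih.1 hE) (hx t hE)
      refine ⟨fun _ => h1, fun h2 => ?_⟩
      by_cases ht : t.succ ∈ W
      · exact h1.trans (hW _ ht)
      · exact absurd (hseg t ht ▸ hE) h2
    · have h1 := P.node_succ_congr (ih.2 hE) (hy t hE)
      refine ⟨fun h2 => ?_, fun _ => h1⟩
      by_cases ht : t.succ ∈ W
      · exact h1.trans (hW _ ht).symm
      · exact absurd (hseg t ht ▸ h2) hE

variable [DecidableEq σ]

/-- The segments in which the coordinate `i` is read on input `x`. -/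
def readSegments (seg : Fin (T + 1) → σ) (x : Fin n → D) (i : Fin n) : Finset σ :=
  (Finset.univ.filter fun t : Fin T => P.queryAt x t = i).image fun t => seg t.castSucc

theorem mem_readSegments (seg : Fin (T + 1) → σ) (x : Fin n → D) (t : Fin T) :
    seg t.castSucc ∈ P.readSegments seg x (P.queryAt x t) :=
  Finset.mem_image_of_mem (fun t : Fin T => seg t.castSucc) (by simp)

theorem sum_card_readSegments_le (seg : Fin (T + 1) → σ) (x : Fin n → D) :
    ∑ i, (P.readSegments seg x i).card ≤ T := by
  calc ∑ i, (P.readSegments seg x i).card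
      ≤ ∑ i, (Finset.univ.filter fun t : Fin T => P.queryAt x t = i).card :=
        Finset.sum_le_sum fun i _ => Finset.card_image_le
    _ = T := by
        rw [← Finset.card_eq_sum_card_fiberwise (fun _ _ => Finset.mem_coe.2 (Finset.mem_univ _))]
        simp

theorem card_filter_mem_readSegments_le (seg : Fin (T + 1) → σ) (x : Fin n → D) (s : σ) {h : ℕ}
    (hs : (Finset.univ.filter fun t : Fin T => seg t.castSucc = s).card ≤ h) :
    (Finset.univ.filter fun i => s ∈ P.readSegments seg x i).card ≤ h := by
  refine (Finset.card_le_card ?_).trans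
    ((Finset.card_image_le (f := P.queryAt x)).trans hs)
  intro i hi
  obtain ⟨t, ht, hts⟩ := Finset.mem_image.1 (Finset.mem_filter.1 hi).2
  exact Finset.mem_image.2 ⟨t, by simpa using hts, (Finset.mem_filter.1 ht).2⟩

/-- On input `x`, the coordinates in `A` are read only in segments of `E`, those in `B` only in
segments outside `E`, and the boundary nodes are those prescribed by `v`. -/
def InClass (seg : Fin (T + 1) → σ) (W : Finset (Fin (T + 1))) (E : Finset σ)
    (A B : Finset (Fin n)) (v : ∀ t : W, P.Layer t) (x : Fin n → D) : Prop :=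
  (∀ i ∈ A, P.readSegments seg x i ⊆ E) ∧ (∀ i ∈ B, Disjoint (P.readSegments seg x i) E) ∧
    ∀ t : W, P.node x t = v t

variable {P}

/-- Inside `E` the run of `x` never reads `B`, where alone the hybrid differs from `x`. Outside `E`
the run of `y` never reads `A`, and off `A` the hybrid equals `y`. So the hybrid follows `x` in `E`
and `y` elsewhere. -/
theorem InClass.eval_piecewise {seg : Fin (T + 1) → σ} {W : Finset (Fin (T + 1))}
    (hseg : ∀ t : Fin T, t.succ ∉ W → seg t.succ = seg t.castSucc) {E : Finset σ}
    {A B : Finset (Fin n)} {v : ∀ t : W, P.Layer t} {x y : Fin n → D} {b : Bool}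
    (hx : P.InClass seg W E A B v x) (hy : P.InClass seg W E A B v y)
    (hxy : ∀ i, i ∉ A → i ∉ B → x i = y i) (hxb : P.eval x = b) (hyb : P.eval y = b) :
    P.eval (B.piecewise y x) = b := by
  have h := P.node_crossover seg W hseg E (x := x) (y := y) (z := B.piecewise y x)
    (fun t ht => (hx.2.2 ⟨t, ht⟩).trans (hy.2.2 ⟨t, ht⟩).symm)
    (fun t ht => Finset.piecewise_eq_of_notMem _ _ _ fun hB =>
      Finset.disjoint_left.1 (hx.2.1 _ hB) (P.mem_readSegments seg x t) ht)
    (fun t ht => by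
      by_cases hB : P.queryAt y t ∈ B
      · exact Finset.piecewise_eq_of_mem _ _ _ hB
      · rw [Finset.piecewise_eq_of_notMem _ _ _ hB]
        exact hxy _ (fun hA => ht (hy.1 _ hA (P.mem_readSegments seg y t))) hB) (Fin.last T)
  by_cases hE : seg (Fin.last T) ∈ E
  · rw [← hxb, eval, eval, h.1 hE]
  · rw [← hyb, eval, eval, h.2 hE]

end Crossover

theorem prod_ite_ite_mem {ι : Type*} [Fintype ι] [DecidableEq ι] {A B : Finset ι}
    (hAB : Disjoint A B) (α β : ℝ) :
    ∏ i, (if i ∈ A then α else if i ∈ B then β else 1) = α ^ A.card * β ^ B.card := by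
  have : ∀ i, (if i ∈ A then α else if i ∈ B then β else 1) =
      (if i ∈ A then α else 1) * (if i ∈ B then β else 1) := by
    intro i
    by_cases hA : i ∈ A
    · simp [hA, Finset.disjoint_left.1 hAB hA]
    · simp [hA]
  rw [Finset.prod_congr rfl fun i _ => this i, Finset.prod_mul_distrib]
  simp

/-! ### Size of a class and number of classes. -/

section Rectangle

variable {σ : Type} [DecidableEq σ] {n N T : ℕ} {P : BranchingProgram (Fin N) n T}

/-- An embedded rectangle of inputs without close pairs is small. -/
theorem card_rectangle_le (hN : 2 ≤ N) (hP : P.Computes (hammingCloseness (1 / 8) n N))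
    {seg : Fin (T + 1) → σ} {W : Finset (Fin (T + 1))}
    (hseg : ∀ t : Fin T, t.succ ∉ W → seg t.succ = seg t.castSucc) {E : Finset σ}
    {A B : Finset (Fin n)} (hAB : Disjoint A B) {v : ∀ t : W, P.Layer t} {m : ℕ}
    (hA : A.card = m) (hB : B.card = m) (K : Finset (Fin n → Fin N))
    (hK : ∀ x ∈ K, P.InClass seg W E A B v x ∧ P.eval x = false)
    (hKeq : ∀ x ∈ K, ∀ y ∈ K, ∀ i, i ∉ A → i ∉ B → x i = y i) :
    (K.card : ℝ) ≤ (2 * (N : ℝ) ^ (1 - 1 / 512 : ℝ)) ^ m * (N : ℝ) ^ m := by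
  set w : ℝ := 2 * (N : ℝ) ^ (1 - 1 / 512 : ℝ) with hw
  let p : Fin n → Finset (Fin N) := fun i => K.image fun x => x i
  have hsub : K ⊆ Fintype.piFinset p := fun x hx =>
    Fintype.mem_piFinset.2 fun i => Finset.mem_image_of_mem (fun x => x i) hx
  have h1 : (K.card : ℝ) ≤ ∏ i, ((p i).card : ℝ) := by
    have := Finset.card_le_card hsub
    rw [Fintype.card_piFinset] at this
    exact_mod_cast this
  have hone : ∀ i, i ∉ A → i ∉ B → ((p i).card : ℝ) ≤ 1 := by
    intro i hiA hiB
    have : (p i).card ≤ 1 := by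
      refine Finset.card_le_one.2 fun a ha b hb => ?_
      obtain ⟨x, hx, rfl⟩ := Finset.mem_image.1 ha
      obtain ⟨y, hy, rfl⟩ := Finset.mem_image.1 hb
      exact hKeq x hx y hy i hiA hiB
    exact_mod_cast this
  have hNle : ∀ i, ((p i).card : ℝ) ≤ N := by
    intro i
    have := Finset.card_le_univ (p i)
    rw [Fintype.card_fin] at this
    exact_mod_cast this
  have hfar : ∀ i ∈ A, ∀ j ∈ B, ((p i).card : ℝ) ≤ w ∨ ((p j).card : ℝ) ≤ w := by
    intro i hi j hj
    refine card_le_or_card_le_of_far hN _ _ fun a ha b hb => ?_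
    obtain ⟨x, hx, rfl⟩ := Finset.mem_image.1 ha
    obtain ⟨y, hy, rfl⟩ := Finset.mem_image.1 hb
    have hz := (hK x hx).1.eval_piecewise hseg (hK y hy).1 (hKeq x hx y hy) (hK x hx).2 (hK y hy).2
    rw [hP, hammingCloseness_eq_false_iff] at hz
    have hiB : i ∉ B := Finset.disjoint_left.1 hAB hi
    have := hz i j (fun h => hiB (h ▸ hj))
    rwa [Finset.piecewise_eq_of_notMem _ _ _ hiB, Finset.piecewise_eq_of_mem _ _ _ hj] at this
  have hprod : ∀ α β : ℝ, (∀ i ∈ A, ((p i).card : ℝ) ≤ α) → (∀ i ∈ B, ((p i).card : ℝ) ≤ β) →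
      (K.card : ℝ) ≤ α ^ m * β ^ m := by
    intro α β hα hβ
    refine h1.trans ((Finset.prod_le_prod (fun _ _ => by positivity) fun i _ => ?_).trans
      (le_of_eq ((prod_ite_ite_mem hAB α β).trans (by rw [hA, hB]))))
    split_ifs with h2 h3
    · exact hα i h2
    · exact hβ i h3
    · exact hone i h2 h3
  -- One large projection in `A` forces all projections in `B` to be small, so one whole side is
  -- small.
  by_cases hall : ∀ i ∈ A, ((p i).card : ℝ) ≤ w
  · exact hprod w N hall fun i _ => hNle i
  · push Not at hall
    obtain ⟨i, hi, hiw⟩ := hall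
    rw [mul_comm]
    exact hprod N w (fun i _ => hNle i) fun j hj => (hfar i hi j hj).resolve_left (not_le.2 hiw)

/-- Fixing the values off `A ∪ B` cuts the class into at most `N ^ (n - 2 * m)` rectangles. -/
theorem card_class_le (hN : 2 ≤ N) (hP : P.Computes (hammingCloseness (1 / 8) n N))
    {seg : Fin (T + 1) → σ} {W : Finset (Fin (T + 1))}
    (hseg : ∀ t : Fin T, t.succ ∉ W → seg t.succ = seg t.castSucc) {E : Finset σ}
    {A B : Finset (Fin n)} (hAB : Disjoint A B) {v : ∀ t : W, P.Layer t} {m : ℕ}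
    (hA : A.card = m) (hB : B.card = m) (K : Finset (Fin n → Fin N))
    (hK : ∀ x ∈ K, P.InClass seg W E A B v x ∧ P.eval x = false) :
    (K.card : ℝ) ≤ (2 * (N : ℝ) ^ (1 - 1 / 512 : ℝ)) ^ m * (N : ℝ) ^ m * (N : ℝ) ^ (n - 2 * m) := by
  have h := Finset.card_le_mul_card_image_of_maps_to (s := K)
    (f := fun x => fun i : {i // i ∈ (A ∪ B)ᶜ} => x i) (t := Finset.univ)
    (fun _ _ => Finset.mem_univ _) ⌊(2 * (N : ℝ) ^ (1 - 1 / 512 : ℝ)) ^ m * (N : ℝ) ^ m⌋₊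
    (fun a _ => by
      refine Nat.le_floor (card_rectangle_le hN hP hseg hAB hA hB (E := E) (v := v) _
        (fun x hx => ?_) (fun x hx y hy i hiA hiB => ?_))
      · exact hK x (Finset.mem_filter.1 hx).1
      · have h1 := (Finset.mem_filter.1 hx).2.trans (Finset.mem_filter.1 hy).2.symm
        exact congrFun h1 ⟨i, by simp [hiA, hiB]⟩)
  rw [Finset.card_univ, Fintype.card_fun, Fintype.card_fin, Fintype.card_coe, Finset.card_compl,
    Finset.card_union_of_disjoint hAB, hA, hB, Fintype.card_fin, ← two_mul] at h
  have h' : (K.card : ℝ) ≤ (⌊(2 * (N : ℝ) ^ (1 - 1 / 512 : ℝ)) ^ m * (N : ℝ) ^ m⌋₊ : ℝ) *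
      (N : ℝ) ^ (n - 2 * m) := by exact_mod_cast h
  refine h'.trans ?_
  gcongr
  exact Nat.floor_le (by positivity)

open Classical in
theorem card_zeros_le [Fintype σ] (hN : 2 ≤ N) (hP : P.Computes (hammingCloseness (1 / 8) n N))
    {seg : Fin (T + 1) → σ} {W : Finset (Fin (T + 1))}
    (hseg : ∀ t : Fin T, t.succ ∉ W → seg t.succ = seg t.castSucc) {m : ℕ}
    (hsplit : ∀ x, ∃ (E : Finset σ) (A B : Finset (Fin n)), A.card = m ∧ B.card = m ∧
      Disjoint A B ∧ (∀ i ∈ A, P.readSegments seg x i ⊆ E) ∧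
        ∀ i ∈ B, Disjoint (P.readSegments seg x i) E) :
    ((Finset.univ.filter fun x : Fin n → Fin N =>
      hammingCloseness (1 / 8) n N x = false).card : ℝ) ≤
      (2 ^ Fintype.card σ * ((n.choose m : ℝ) * (n.choose m * ∏ t ∈ W, Fintype.card (P.Layer t)))) *
      ((2 * (N : ℝ) ^ (1 - 1 / 512 : ℝ)) ^ m * (N : ℝ) ^ m * (N : ℝ) ^ (n - 2 * m)) := by
  set b := (2 * (N : ℝ) ^ (1 - 1 / 512 : ℝ)) ^ m * (N : ℝ) ^ m * (N : ℝ) ^ (n - 2 * m) with hb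
  let keys : Finset (Finset σ × Finset (Fin n) × Finset (Fin n) × (∀ t : W, P.Layer t)) :=
    Finset.univ ×ˢ Finset.powersetCard m Finset.univ ×ˢ Finset.powersetCard m Finset.univ ×ˢ
      Finset.univ
  let cls : (Finset σ × Finset (Fin n) × Finset (Fin n) × (∀ t : W, P.Layer t)) →
      Finset (Fin n → Fin N) := fun k => Finset.univ.filter fun x =>
    P.eval x = false ∧ Disjoint k.2.1 k.2.2.1 ∧ P.InClass seg W k.1 k.2.1 k.2.2.1 k.2.2.2 x
  have hcov : (Finset.univ.filter fun x : Fin n → Fin N =>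
      hammingCloseness (1 / 8) n N x = false) ⊆ keys.biUnion cls := by
    intro x hx
    obtain ⟨E, A, B, hA, hB, hAB, h1, h2⟩ := hsplit x
    refine Finset.mem_biUnion.2 ⟨(E, A, B, fun t => P.node x t), ?_, ?_⟩
    · simp [keys, Finset.mem_powersetCard, hA, hB]
    · refine Finset.mem_filter.2 ⟨Finset.mem_univ _, ?_, hAB, h1, h2, fun _ => rfl⟩
      rw [hP]
      exact (Finset.mem_filter.1 hx).2
  have hcls : ∀ k ∈ keys, (cls k).card ≤ ⌊b⌋₊ := by
    rintro ⟨E, A, B, v⟩ hk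
    simp only [keys, Finset.mem_product, Finset.mem_powersetCard, Finset.mem_univ, true_and,
      and_true, Finset.subset_univ] at hk
    by_cases hAB : Disjoint A B
    · refine Nat.le_floor (card_class_le hN hP hseg hAB hk.1 hk.2 (E := E) (v := v) _ fun x hx => ?_)
      have := (Finset.mem_filter.1 hx).2
      exact ⟨this.2.2, this.1⟩
    · have : cls (E, A, B, v) = ∅ := Finset.filter_eq_empty_iff.2 fun x _ hx => hAB hx.2.1
      simp [this]
  have h := (Finset.card_le_card hcov).trans (Finset.card_biUnion_le_card_mul _ _ _ hcls)
  have hkeys : keys.card = 2 ^ Fintype.card σ *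
      (n.choose m * (n.choose m * ∏ t ∈ W, Fintype.card (P.Layer t))) := by
    simp only [keys, Finset.card_product, Finset.card_powersetCard, Finset.card_univ,
      Fintype.card_finset, Fintype.card_fin, Fintype.card_pi]
    rw [Finset.prod_coe_sort W fun t => Fintype.card (P.Layer t)]
  rw [hkeys] at h
  calc _ ≤ ((2 ^ Fintype.card σ * (n.choose m * (n.choose m *
        ∏ t ∈ W, Fintype.card (P.Layer t))) * ⌊b⌋₊ : ℕ) : ℝ) := by exact_mod_cast h
    _ ≤ _ := by
        push_cast
        gcongr
        exact Nat.floor_le (by positivity)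

end Rectangle

end BranchingProgram

/-! ### Choice of the segment boundaries and estimates of binomial coefficients. -/

theorem card_filter_dvd_add_le_one (h t : ℕ) :
    ((Finset.range h).filter fun c => h ∣ t + c).card ≤ 1 := by
  refine Finset.card_le_one.2 fun a ha b hb => ?_
  rw [Finset.mem_filter, Finset.mem_range] at ha hb
  have h1 : t + a ≡ t + b [MOD h] :=
    ((Nat.modEq_zero_iff_dvd).2 ha.2).trans ((Nat.modEq_zero_iff_dvd).2 hb.2).symm
  exact (Nat.ModEq.add_left_cancel' t h1).eq_of_lt_of_lt ha.1 hb.1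

/-- Among the `h` residues some residue carries at most a `1 / h` fraction of the total weight. -/
theorem exists_offset_mul_sum_le {T h : ℕ} (hh : 1 ≤ h) (f : Fin (T + 1) → ℝ) (hf : ∀ t, 0 ≤ f t) :
    ∃ c < h, h * ∑ t ∈ Finset.univ.filter (fun t : Fin (T + 1) => h ∣ t + c), f t ≤ ∑ t, f t := by
  by_contra! hcon
  have h1 : ∑ c ∈ Finset.range h, ∑ t, f t < ∑ c ∈ Finset.range h,
      h * ∑ t ∈ Finset.univ.filter (fun t : Fin (T + 1) => h ∣ t + c), f t :=
    Finset.sum_lt_sum_of_nonempty (Finset.nonempty_range_iff.2 (by omega))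
      fun c hc => hcon c (Finset.mem_range.1 hc)
  have h2 : ∑ c ∈ Finset.range h,
      ∑ t ∈ Finset.univ.filter (fun t : Fin (T + 1) => h ∣ t + c), f t ≤ ∑ t, f t := by
    simp only [Finset.sum_filter]
    rw [Finset.sum_comm]
    refine Finset.sum_le_sum fun t _ => ?_
    rw [← Finset.sum_filter, Finset.sum_const, nsmul_eq_mul]
    have : (((Finset.range h).filter fun c => h ∣ (t : ℕ) + c).card : ℝ) ≤ 1 := by
      exact_mod_cast card_filter_dvd_add_le_one h t
    exact mul_le_of_le_one_left (hf t) this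
  rw [Finset.sum_const, Finset.card_range, nsmul_eq_mul, ← Finset.mul_sum] at h1
  have hh' : (0 : ℝ) < h := by exact_mod_cast hh
  exact absurd (lt_of_mul_lt_mul_left h1 hh'.le) (not_lt.2 h2)

theorem card_filter_add_div_eq_le {T h c s : ℕ} (hh : 1 ≤ h) :
    (Finset.univ.filter fun t : Fin T => ((t : ℕ) + c) / h = s).card ≤ h := by
  have := Finset.card_le_card_of_injOn
    (s := Finset.univ.filter fun t : Fin T => ((t : ℕ) + c) / h = s)
    (t := Finset.Ico (s * h) (s * h + h)) (fun t => (t : ℕ) + c)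
    (fun t ht => by
      have h1 : ((t : ℕ) + c) / h = s := by simpa using ht
      rw [Nat.div_eq_iff (by omega)] at h1
      simp only [Finset.coe_Ico, Set.mem_Ico]
      omega)
    (fun a _ b _ hab => Fin.ext (by simpa using hab))
  simpa using this

/-- From `n.choose m ≤ n ^ m / m!` and `m ^ m / m! ≤ e ^ m ≤ 4 ^ m`. -/
theorem logb_choose_le {n m b : ℕ} (hm : 1 ≤ m) (hmn : m ≤ n) (hb : n ≤ 2 ^ b * m) :
    Real.logb 2 (n.choose m) ≤ m * (b + 2) := by
  have hm' : (0 : ℝ) < m := by exact_mod_cast hm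
  have h1 : (n.choose m : ℝ) ≤ (2 ^ (b + 2)) ^ m := by
    have hb' : (n : ℝ) ≤ 2 ^ b * m := by exact_mod_cast hb
    have he : Real.exp m ≤ 4 ^ m := by
      have h := Real.exp_one_lt_d9
      rw [← Real.exp_one_pow]
      exact pow_le_pow_left₀ (Real.exp_pos _).le (by linarith) m
    calc (n.choose m : ℝ) ≤ (n : ℝ) ^ m / m.factorial := Nat.choose_le_pow_div m n
      _ ≤ (2 ^ b * m : ℝ) ^ m / m.factorial := by gcongr
      _ = (2 ^ b) ^ m * ((m : ℝ) ^ m / m.factorial) := by rw [mul_pow]; ring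
      _ ≤ (2 ^ b) ^ m * 4 ^ m := by
          gcongr
          exact (Real.pow_div_factorial_le_exp m hm'.le m).trans he
      _ = (2 ^ (b + 2)) ^ m := by rw [← mul_pow, pow_add]; norm_num
  have h0 : (0 : ℝ) < n.choose m := by exact_mod_cast Nat.choose_pos hmn
  have h2 := Real.logb_le_logb_of_le one_lt_two h0 h1
  rw [Real.logb_pow, Real.logb_pow, Real.logb_self_eq_one one_lt_two] at h2
  push_cast at h2
  linarith

/-! ### From the counting bound to cumulative memory. -/

namespace BranchingProgram

section

variable {n N T : ℕ} {P : BranchingProgram (Fin N) n T}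

theorem logb_card_layer_nonneg {D : Type} (P : BranchingProgram D n T) (t : Fin (T + 1)) :
    0 ≤ Real.logb 2 (Fintype.card (P.Layer t)) := by
  rcases Nat.eq_zero_or_pos (Fintype.card (P.Layer t)) with h | h
  · simp [h]
  · exact Real.logb_nonneg one_lt_two (by exact_mod_cast h)

open Classical in
theorem card_zeros_le_of_cumulativeMemory (hN : 2 ≤ N) (hn : 1 ≤ n)
    (hP : P.Computes (hammingCloseness (1 / 8) n N)) {h K m : ℕ} (hh : 1 ≤ h) (hK : 1 ≤ K)
    (hTK : T ≤ K * n) (hTh : 8 * (T * h) ≤ n ^ 2) (hm : 16 * m * 16 ^ K ≤ n) :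
    ((Finset.univ.filter fun x : Fin n → Fin N =>
      hammingCloseness (1 / 8) n N x = false).card : ℝ) ≤
      (2 ^ (T / h + 2) * ((n.choose m : ℝ) * (n.choose m * 2 ^ (P.cumulativeMemory / h)))) *
      ((2 * (N : ℝ) ^ (1 - 1 / 512 : ℝ)) ^ m * (N : ℝ) ^ m * (N : ℝ) ^ (n - 2 * m)) := by
  obtain ⟨c, hc, hsum⟩ := exists_offset_mul_sum_le hh
    (fun t => Real.logb 2 (Fintype.card (P.Layer t))) P.logb_card_layer_nonneg
  set W := Finset.univ.filter (fun t : Fin (T + 1) => h ∣ t + c) with hW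
  have hlt : ∀ t : Fin (T + 1), ((t : ℕ) + c) / h < T / h + 2 := by
    intro t
    have h1 : ((t : ℕ) + c) / h ≤ (T + h) / h := Nat.div_le_div_right (by have := t.2; omega)
    rw [Nat.add_div_right _ (by omega)] at h1
    omega
  -- As `c < h`, the shifted quotient is at most `T / h + 1`, which accounts for `T / h + 2`
  -- segments.
  let seg : Fin (T + 1) → Fin (T / h + 2) := fun t => ⟨((t : ℕ) + c) / h, hlt t⟩
  have hseg : ∀ t : Fin T, t.succ ∉ W → seg t.succ = seg t.castSucc := by
    intro t ht
    have h1 : ¬ h ∣ (t : ℕ) + c + 1 := by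
      intro h2
      refine ht (Finset.mem_filter.2 ⟨Finset.mem_univ _, ?_⟩)
      rw [Fin.val_succ, add_right_comm]
      exact h2
    refine Fin.ext ?_
    simp only [seg, Fin.val_succ, Fin.val_castSucc]
    rw [add_right_comm, Nat.succ_div, if_neg h1, add_zero]
  have hfib : ∀ s, (Finset.univ.filter fun t : Fin T => seg t.castSucc = s).card ≤ h := by
    intro s
    refine le_trans (Finset.card_le_card fun t ht => ?_)
      (card_filter_add_div_eq_le (T := T) (c := c) (s := s) hh)
    have := (Finset.mem_filter.1 ht).2
    exact Finset.mem_filter.2 ⟨Finset.mem_univ _, congrArg Fin.val this⟩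
  have hmain := card_zeros_le hN hP hseg (m := m) fun x =>
    exists_split_of_sum_card_le (P.readSegments seg x) (T := T) (K := K) (h := h)
      (by rw [Fintype.card_fin]; exact hn) hK (P.sum_card_readSegments_le seg x) (by simpa using hTK)
      (fun s => P.card_filter_mem_readSegments_le seg x s (hfib s)) (by simpa using hTh)
      (by simpa using hm)
  have hprod : (∏ t ∈ W, (Fintype.card (P.Layer t) : ℝ)) ≤ 2 ^ (P.cumulativeMemory / h) := by
    have hh' : (0 : ℝ) < h := by exact_mod_cast hh
    calc (∏ t ∈ W, (Fintype.card (P.Layer t) : ℝ))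
        = ∏ t ∈ W, (2 : ℝ) ^ Real.logb 2 (Fintype.card (P.Layer t)) := by
          refine Finset.prod_congr rfl fun t _ => ?_
          -- Some computation reaches every layer, so no layer is empty.
          have : 0 < Fintype.card (P.Layer t) :=
            Fintype.card_pos_iff.2 ⟨P.node (fun _ => ⟨0, by omega⟩) t⟩
          rw [Real.rpow_logb two_pos (by norm_num) (by exact_mod_cast this)]
      _ = 2 ^ ∑ t ∈ W, Real.logb 2 (Fintype.card (P.Layer t)) :=
          (Real.rpow_sum_of_pos two_pos _ _).symm
      _ ≤ 2 ^ (P.cumulativeMemory / h) := by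
          refine Real.rpow_le_rpow_of_exponent_le one_le_two ?_
          rw [le_div_iff₀ hh', mul_comm]
          exact hsum
  rw [Fintype.card_fin] at hmain
  push_cast at hmain
  refine hmain.trans ?_
  gcongr

/-- The logarithmic form of the counting bound. -/
theorem mul_logb_le_cumulativeMemory (hN : 2 ≤ N) (hn : (4 : ℝ) ≤ (n : ℝ) ^ (0.0024107 : ℝ))
    (hnN : (n : ℝ) ^ (4.39 : ℝ) ≤ N) (hn1 : 1 ≤ n)
    (hP : P.Computes (hammingCloseness (1 / 8) n N)) {h K m : ℕ} (hh : 1 ≤ h) (hK : 1 ≤ K)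
    (hTK : T ≤ K * n) (hTh : 8 * (T * h) ≤ n ^ 2) (hm : 16 * m * 16 ^ K ≤ n) (hm1 : 1 ≤ m)
    (hm2 : n ≤ 32 * m * 16 ^ K) :
    m * (Real.logb 2 N / 512 - 8 * K - 15) ≤ (T / h : ℕ) + 3 + P.cumulativeMemory / h := by
  classical
  have hN' : (0 : ℝ) < N := by positivity
  have hmn : 2 * m ≤ n := by
    have : 1 ≤ 16 ^ K := Nat.one_le_pow _ _ (by norm_num)
    nlinarith
  have h1 := pow_le_two_mul_card_zeros hn hnN
  have h2 := card_zeros_le_of_cumulativeMemory hN hn1 hP hh hK hTK hTh hm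
  have hc0 : (0 : ℝ) < n.choose m := by exact_mod_cast Nat.choose_pos (by omega)
  -- Since `32 * 16 ^ K = 2 ^ (4 * K + 5)`, the two binomials cost `m * (8 * K + 14)`; the factor `2
  -- ^ m` in the class bound raises 14 to 15.
  have hch := logb_choose_le (b := 4 * K + 5) hm1 (show m ≤ n by omega) (by
    refine hm2.trans (le_of_eq ?_)
    rw [pow_add, pow_mul]; norm_num; ring)
  push_cast at hch
  have hb0 : (0 : ℝ) < 2 * (N : ℝ) ^ (1 - 1 / 512 : ℝ) := by positivity
  have hsplit : (N : ℝ) ^ n = (N : ℝ) ^ m * ((N : ℝ) ^ m * (N : ℝ) ^ (n - 2 * m)) := by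
    rw [← pow_add, ← pow_add]; congr 1; omega
  have h3 : (N : ℝ) ^ m ≤ 2 * ((2 ^ (T / h + 2) * ((n.choose m : ℝ) *
      (n.choose m * 2 ^ (P.cumulativeMemory / h)))) * (2 * (N : ℝ) ^ (1 - 1 / 512 : ℝ)) ^ m) := by
    refine le_of_mul_le_mul_right (a := (N : ℝ) ^ m * (N : ℝ) ^ (n - 2 * m)) ?_ (by positivity)
    rw [← hsplit]
    refine h1.trans ((mul_le_mul_of_nonneg_left h2 two_pos.le).trans (le_of_eq ?_))
    ring
  have h4 := Real.logb_le_logb_of_le one_lt_two (by positivity) h3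
  have hrp : (0 : ℝ) < 2 ^ (P.cumulativeMemory / h) := by positivity
  rw [Real.logb_mul (by norm_num) (by positivity), Real.logb_mul (by positivity) (by positivity),
    Real.logb_mul (by positivity) (by positivity), Real.logb_mul hc0.ne' (by positivity),
    Real.logb_mul hc0.ne' hrp.ne', Real.logb_pow, Real.logb_pow, Real.logb_pow,
    Real.logb_mul (by norm_num) (by positivity), Real.logb_rpow_eq_mul_logb_of_pos hN',
    Real.logb_rpow two_pos (by norm_num), Real.logb_self_eq_one one_lt_two] at h4
  push_cast at h4 ⊢
  nlinarith

/-- A program for Hamming closeness has to read all coordinates on inputs without close pairs. -/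
theorem le_length_of_computes (hN : 2 ≤ N) (hn : (4 : ℝ) ≤ (n : ℝ) ^ (0.0024107 : ℝ))
    (hnN : (n : ℝ) ^ (4.39 : ℝ) ≤ N) (hn2 : 2 ≤ n)
    (hP : P.Computes (hammingCloseness (1 / 8) n N)) : n ≤ T := by
  classical
  by_contra! hT
  have h1 := pow_le_two_mul_card_zeros hn hnN
  have h2 : 0 < (Finset.univ.filter fun x : Fin n → Fin N =>
      hammingCloseness (1 / 8) n N x = false).card := by
    have : (0 : ℝ) < (N : ℝ) ^ n := by positivity
    have h3 := this.trans_le h1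
    by_contra! h0
    rw [Nat.le_zero.1 h0] at h3
    simp at h3
  obtain ⟨x, hx⟩ := Finset.card_pos.1 h2
  have hx0 := (Finset.mem_filter.1 hx).2
  obtain ⟨i, hi⟩ : ∃ i, ∀ t, P.queryAt x t ≠ i := by
    by_contra! hcon
    have := Fintype.card_le_of_surjective (P.queryAt x) hcon
    simp only [Fintype.card_fin] at this
    omega
  have : Nontrivial (Fin n) := Fin.nontrivial_iff_two_le.2 hn2
  obtain ⟨j, hj⟩ := exists_ne i
  -- Copying `x j` into an unread coordinate creates a pair at distance 0 unnoticed by the program.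
  have hz : P.eval (Function.update x i (x j)) = P.eval x := by
    rw [eval, eval, P.node_eq_of_forall_queryAt fun t => Function.update_of_ne (hi t) _ _]
  rw [hP, hP, hx0, hammingCloseness_eq_false_iff] at hz
  have h3 := hz i j hj.symm
  rw [Function.update_self, Function.update_of_ne hj, hammingDist_self] at h3
  have h4 : 0 ≤ Real.logb 2 N := Real.logb_nonneg one_lt_two (by exact_mod_cast (by omega : 1 ≤ N))
  push_cast at h3
  linarith

end

end BranchingProgram

/-- The bound for a fixed large `n`, with `T` at most a small multiple of `n log n`. -/
theorem BranchingProgram.sq_mul_logb_div_le_cumulativeMemory {n N T : ℕ}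
    {P : BranchingProgram (Fin N) n T} (hn : (4 : ℝ) ≤ (n : ℝ) ^ (0.0024107 : ℝ))
    (hlog : 100000 ≤ Real.logb 2 n)
    (hsqrt : (Real.logb 2 n ^ 2 + 5) * 32 ≤ (n : ℝ) ^ (1 / 2 : ℝ))
    (hnN : (n : ℝ) ^ (4.39 : ℝ) ≤ N) (hT : (T : ℝ) ≤ 1 / 10000 * (n * Real.logb 2 n))
    (hP : P.Computes (hammingCloseness (1 / 8) n N)) :
    (n : ℝ) ^ 2 * Real.logb 2 n / (2 : ℝ) ^ (26 * ((T : ℝ) / n)) ≤ P.cumulativeMemory := by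
  set L := Real.logb 2 n with hL
  have hn0 : (0 : ℝ) < n := by
    rcases Nat.eq_zero_or_pos n with rfl | h
    · rw [Nat.cast_zero, Real.zero_rpow (by norm_num)] at hn; linarith
    · exact_mod_cast h
  have hss : (n : ℝ) ^ (1 / 2 : ℝ) * (n : ℝ) ^ (1 / 2 : ℝ) = n := by
    rw [← Real.rpow_add hn0]; norm_num
  set s := (n : ℝ) ^ (1 / 2 : ℝ) with hs
  have hs1 : 100000 ≤ s := by nlinarith
  have hLn : L ≤ n := by nlinarith
  have hn2 : 2 ≤ n := by
    have : (2 : ℝ) ≤ n := by linarith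
    exact_mod_cast this
  have hn1 : (1 : ℝ) ≤ n := by linarith
  have hnN' : (n : ℝ) ≤ N := by
    refine le_trans ?_ hnN
    conv_lhs => rw [← Real.rpow_one (n : ℝ)]
    exact Real.rpow_le_rpow_of_exponent_le hn1 (by norm_num)
  have hN : 2 ≤ N := hn2.trans (by exact_mod_cast hnN')
  have hlogN : 4.39 * L ≤ Real.logb 2 N := by
    have := Real.logb_le_logb_of_le one_lt_two (by positivity) hnN
    rwa [Real.logb_rpow_eq_mul_logb_of_pos hn0] at this
  have hnT : n ≤ T := BranchingProgram.le_length_of_computes hN hn hnN hn2 hP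
  have hnT' : (n : ℝ) ≤ T := by exact_mod_cast hnT
  have hT0 : (0 : ℝ) < T := by linarith
  obtain ⟨k, hk⟩ : ∃ k : ℝ, (T : ℝ) / n = k := ⟨_, rfl⟩
  rw [hk]
  have hTk : (T : ℝ) = k * n := by rw [← hk]; field_simp
  -- Reading all coordinates gives `T / n ≥ 1`, which lets constant factors be absorbed into `2 ^ (C
  -- * k)`.
  have hk1 : 1 ≤ k := hk ▸ (one_le_div hn0).2 hnT'
  have hkL : k ≤ L / 10000 := by
    rw [← hk, div_le_iff₀ hn0]; linarith
  set K := ⌈k⌉₊ with hK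
  have hK1 : 1 ≤ K := Nat.one_le_ceil_iff.2 (by linarith)
  have hKk : (K : ℝ) ≤ 2 * k := by
    have := Nat.ceil_lt_add_one (show 0 ≤ k by linarith)
    linarith
  have hTK : T ≤ K * n := by
    have : (T : ℝ) ≤ K * n := by
      rw [hTk]; exact mul_le_mul_of_nonneg_right (Nat.le_ceil k) hn0.le
    exact_mod_cast this
  have h16K : (16 : ℝ) ^ K ≤ 2 ^ (8 * k) := by
    rw [show (16 : ℝ) = 2 ^ (4 : ℝ) by norm_num, ← Real.rpow_natCast, ← Real.rpow_mul two_pos.le]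
    exact Real.rpow_le_rpow_of_exponent_le one_le_two (by linarith)
  have h16s : (16 : ℝ) ^ K ≤ s := by
    refine h16K.trans ?_
    have e : s = 2 ^ (L * (1 / 2)) := by
      rw [hs, Real.rpow_mul two_pos.le, hL, Real.rpow_logb two_pos (by norm_num) hn0]
    rw [e]
    exact Real.rpow_le_rpow_of_exponent_le one_le_two (by linarith)
  -- the segment length
  obtain ⟨h, hh1, hTh, hh2⟩ : ∃ h : ℕ, 1 ≤ h ∧ 8 * (T * h) ≤ n ^ 2 ∧ n ^ 2 ≤ 16 * T * h := by
    have hle : 8 * T ≤ n ^ 2 := by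
      have : (8 * T : ℝ) ≤ (n : ℝ) ^ 2 := by nlinarith
      exact_mod_cast this
    have hT8 : 0 < 8 * T := by omega
    have hpos : 1 ≤ n ^ 2 / (8 * T) := (Nat.one_le_div_iff hT8).2 hle
    refine ⟨n ^ 2 / (8 * T), hpos, ?_, ?_⟩
    · rw [← mul_assoc]; exact Nat.mul_div_le _ _
    · have := Nat.lt_mul_div_succ (n ^ 2) hT8
      nlinarith
  -- the number of coordinates on each side of the rectangle
  obtain ⟨m, hm1, hm, hm2⟩ : ∃ m : ℕ, 1 ≤ m ∧ 16 * m * 16 ^ K ≤ n ∧ n ≤ 32 * m * 16 ^ K := by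
    have hle : 16 * 16 ^ K ≤ n := by
      have : (16 * 16 ^ K : ℝ) ≤ n := by nlinarith
      exact_mod_cast this
    have h16 : 0 < 16 * 16 ^ K := by positivity
    have hpos : 1 ≤ n / (16 * 16 ^ K) := (Nat.one_le_div_iff h16).2 hle
    refine ⟨n / (16 * 16 ^ K), hpos, ?_, ?_⟩
    · rw [mul_right_comm]; exact Nat.mul_div_le _ _
    · have := Nat.lt_mul_div_succ n h16
      nlinarith
  have hmain := BranchingProgram.mul_logb_le_cumulativeMemory hN hn hnN (by omega) hP hh1 hK1 hTK
    hTh hm hm1 hm2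
  have hm0 : (0 : ℝ) < m := by exact_mod_cast hm1
  have hh0 : (0 : ℝ) < h := by exact_mod_cast hh1
  have hm2' : (n : ℝ) ≤ 32 * m * 16 ^ K := by exact_mod_cast hm2
  have hh2' : (n : ℝ) ^ 2 ≤ 16 * T * h := by exact_mod_cast hh2
  have hnkh : (n : ℝ) ≤ 16 * k * h := by
    refine le_of_mul_le_mul_right ?_ hn0
    rw [hTk] at hh2'
    linarith
  -- The segment overhead is `O(k²) = O(log² n)`, whereas `m ≥ √n / 32`.
  have hR : ((T / h : ℕ) : ℝ) + 3 ≤ m := by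
    have e1 : ((T / h : ℕ) : ℝ) ≤ 16 * k ^ 2 := by
      refine Nat.cast_div_le.trans ?_
      rw [div_le_iff₀ hh0, hTk]
      calc k * n ≤ k * (16 * k * h) := by gcongr
        _ = 16 * k ^ 2 * h := by ring
    have e2 : s ≤ 32 * m := by
      have e3 : s * s ≤ (32 * m) * s := by
        rw [hss]
        exact hm2'.trans (by gcongr)
      exact le_of_mul_le_mul_right e3 (by linarith)
    have e4 : k ^ 2 ≤ (L / 10000) ^ 2 := pow_le_pow_left₀ (by linarith) hkL 2
    rw [div_pow] at e4
    linarith [sq_nonneg L]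
  have hCM : (m : ℝ) * (L / 256) * h ≤ P.cumulativeMemory := by
    rw [← le_div_iff₀ hh0]
    -- The extra `- 1` pays for the segment overhead; `log₂ N ≥ 4.39 L` and `K ≤ L / 5000` leave
    -- more than `L / 256`.
    have : (m : ℝ) * (L / 256) ≤ m * (Real.logb 2 N / 512 - 8 * K - 15 - 1) := by
      gcongr
      linarith
    linarith
  refine le_trans ?_ hCM
  rw [div_le_iff₀ (by positivity)]
  have h2k : k ≤ 2 ^ k := by
    have := one_add_mul_self_le_rpow_one_add (s := 1) (by norm_num) hk1
    norm_num at this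
    linarith
  have h17 : (2 : ℝ) ^ 17 ≤ 2 ^ (17 * k) := by
    rw [← Real.rpow_natCast]
    exact Real.rpow_le_rpow_of_exponent_le one_le_two (by push_cast; linarith)
  -- The constant is `26 = 17 + 1 + 8`: `16 * 32 * 256 = 2 ^ 17`, `k ≤ 2 ^ k` and `16 ^ K ≤ 2 ^ (8 *
  -- k)`.
  have h26 : (2 : ℝ) ^ (26 * k) = 2 ^ (17 * k) * 2 ^ k * 2 ^ (8 * k) := by
    rw [← Real.rpow_add two_pos, ← Real.rpow_add two_pos]; congr 1; ring
  have hL0 : 0 ≤ L := by linarith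
  calc (n : ℝ) ^ 2 * L = n * n * L := by ring
    _ ≤ (16 * k * h) * (32 * m * 16 ^ K) * L := by gcongr
    _ = m * (L / 256) * h * (2 ^ 17 * k * 16 ^ K) := by ring
    _ ≤ m * (L / 256) * h * (2 ^ (17 * k) * 2 ^ k * 2 ^ (8 * k)) := by gcongr
    _ = m * (L / 256) * h * 2 ^ (26 * k) := by rw [h26]

/-! ### Asymptotics in `n`. -/

theorem eventually_logb_sq_le_sqrt :
    ∀ᶠ n : ℕ in atTop, (Real.logb 2 n ^ 2 + 5) * 32 ≤ (n : ℝ) ^ (1 / 2 : ℝ) := by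
  have h1 : (fun x : ℝ => Real.logb 2 x ^ 2) =o[atTop] fun x : ℝ => x ^ (1 / 2 : ℝ) := by
    have h := (isLittleO_log_rpow_rpow_atTop 2 (show (0 : ℝ) < 1 / 2 by norm_num))
    refine (h.const_mul_left ((Real.log 2)⁻¹ ^ 2)).congr_left fun x => ?_
    rw [Real.rpow_two, Real.logb]
    ring
  have h2 : (fun _ : ℝ => (5 : ℝ)) =o[atTop] fun x : ℝ => x ^ (1 / 2 : ℝ) :=
    isLittleO_const_left.2 (Or.inr
      (tendsto_norm_atTop_atTop.comp (tendsto_rpow_atTop (by norm_num))))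
  have h3 := ((h1.add h2).bound (show (0 : ℝ) < 1 / 32 by norm_num))
  filter_upwards [tendsto_natCast_atTop_atTop.eventually h3] with n hn
  rw [Real.norm_of_nonneg (by positivity), Real.norm_of_nonneg (by positivity)] at hn
  linarith

theorem mainTheorem11 :
    ∃ C : ℝ, 0 < C ∧
      ∀ τ : ℕ → ℝ, τ =o[atTop] (fun n : ℕ => (n : ℝ) * Real.logb 2 n) →
        ∃ ε : ℕ → ℝ, Tendsto ε atTop (𝓝 0) ∧
          ∀ᶠ n : ℕ in atTop, ∀ N : ℕ, (n : ℝ) ^ (4.39 : ℝ) ≤ (N : ℝ) →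
            ∀ T : ℕ, (T : ℝ) ≤ τ n →
              ∀ P : BranchingProgram (Fin N) n T, P.Computes (hammingCloseness (1 / 8) n N) →
                (n : ℝ) ^ 2 * Real.logb 2 n / (2 : ℝ) ^ (C * ((T : ℝ) / n))
                    ≤ P.cumulativeMemory ∧
                (n : ℝ) ^ (2 - ε n)
                    ≤ (n : ℝ) ^ 2 * Real.logb 2 n / (2 : ℝ) ^ (C * ((T : ℝ) / n)) := by
  -- This `ε` is chosen so that `2 ^ (26 * T / n) ≤ n ^ ε n` whenever `T ≤ τ n`; the remaining
  -- factor `log₂ n ≥ 1` is dropped.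
  refine ⟨26, by norm_num, fun τ hτ => ⟨fun n => 26 * |τ n / (n * Real.logb 2 n)|, ?_, ?_⟩⟩
  · have h := hτ.tendsto_div_nhds_zero.abs.const_mul 26
    simpa using h
  have hlog : Tendsto (fun n : ℕ => Real.logb 2 n) atTop atTop :=
    (Real.tendsto_logb_atTop one_lt_two).comp tendsto_natCast_atTop_atTop
  have hpow : Tendsto (fun n : ℕ => (n : ℝ) ^ (0.0024107 : ℝ)) atTop atTop :=
    (tendsto_rpow_atTop (by norm_num)).comp tendsto_natCast_atTop_atTop
  filter_upwards [hpow.eventually_ge_atTop 4, hlog.eventually_ge_atTop 100000,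
    eventually_logb_sq_le_sqrt, hτ.bound (show (0 : ℝ) < 1 / 10000 by norm_num),
    eventually_gt_atTop 0] with n hn hL hsqrt hτn hn0 N hnN T hT P hP
  have hn0' : (0 : ℝ) < n := by exact_mod_cast hn0
  have hL0 : 0 < Real.logb 2 n := by linarith
  have hnL : 0 < (n : ℝ) * Real.logb 2 n := by positivity
  constructor
  · refine P.sq_mul_logb_div_le_cumulativeMemory hn hL hsqrt hnN ?_ hP
    rw [Real.norm_of_nonneg hnL.le] at hτn
    exact hT.trans ((le_abs_self _).trans hτn)
  · have hexp : 26 * ((T : ℝ) / n) ≤ Real.logb 2 n * (26 * |τ n / (n * Real.logb 2 n)|) := by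
      rw [abs_div, abs_of_pos hnL]
      have : Real.logb 2 n * (26 * (|τ n| / (n * Real.logb 2 n))) = 26 * (|τ n| / n) := by
        field_simp
      rw [this]
      gcongr
      exact hT.trans (le_abs_self _)
    have hpow2 : (2 : ℝ) ^ (26 * ((T : ℝ) / n)) ≤
        (n : ℝ) ^ (26 * |τ n / (n * Real.logb 2 n)|) := by
      refine (Real.rpow_le_rpow_of_exponent_le one_le_two hexp).trans (le_of_eq ?_)
      rw [Real.rpow_mul two_pos.le, Real.rpow_logb two_pos (by norm_num) hn0']
    rw [Real.rpow_sub hn0', Real.rpow_two]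
    have hone : (n : ℝ) ^ 2 ≤ (n : ℝ) ^ 2 * Real.logb 2 n :=
      le_mul_of_one_le_right (by positivity) (by linarith)
    gcongr
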